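/- Let $n \ge 1$. Identify a binary vector $x = (x_0, x_1, \dots, x_{n-1}) \in \mathbb{F}_2^n$ with the integer $x_0 2^{n-1} + x_1 2^{n-2} + \dots + x_{n-1}$ ($x_0$ is the most significant bit), and let $x + y$ denote addition modulo $2^n$ under this identification. Let $x \oplus y$ be the coordinatewise sum modulo $2$, and let $x \lll r = (x_r, \dots, x_{n-1}, x_0, \dots, x_{r-1})$ be the rotation of $x$ by $r$ bits to the left. For $\alpha, \beta, \gamma \in \mathbb{F}_2^n$ and $0 \le r \le n-1$ let $$\mathrm{adp}^{\mathrm{XR}}_r(\alpha, \beta \to \gamma) = 2^{-2n}\, \#\bigl\{(x, y) \in \mathbb{F}_2^n \times \mathbb{F}_2^n : \bigl((x+\alpha) \oplus (y+\beta)\bigr) \lll r = \bigl((x \oplus y) \lll r\bigr) + \gamma\bigr\}$$ be the additive differential probability of the function $(x, y) \mapsto (x \oplus y) \lll r$, and let $N(n, r)$ be the number of its impossible differentials, i.e. the number of triples $(\alpha, \beta, \gamma) \in (\mathbb{F}_2^n)^3$ such that $\mathrm{adp}^{\mathrm{XR}}_r(\alpha, \beta \to \gamma) = 0$. Let $n \ge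 5$. Then $N(n, r) < N(n, 1)$ for every integer $r$ with $2 \le r \le n-1$. That is, among the rotations by $1, \dots, n-1$ bits, the one-bit left rotation has strictly the most impossible differentials. -/

import Mathlib

/-!
Elements of `𝔽₂ⁿ` are bit vectors `BitVec n`. The value `x.toNat` is the integer represented by
`x`, `+` on `BitVec n` is addition modulo `2 ^ n`, `^^^` is the bitwise XOR, and
`x.rotateLeft r` is the cyclic rotation of `x` by `r` positions toward the most
significant bit.
-/

/-- The additive differential probability of `f : (𝔽₂ⁿ)ᵏ → 𝔽₂ⁿ` for the input differences
`α 0, …, α (k - 1)` and the output difference `δ`: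
`2 ^ (-k n) * #{x | f (x + α) = f x + δ}`, where all the additions are modulo `2 ^ n`. -/
noncomputable def adp {n k : ℕ} (f : (Fin k → BitVec n) → BitVec n)
    (α : Fin k → BitVec n) (δ : BitVec n) : ℚ :=
  (Nat.card {x : Fin k → BitVec n // f (fun i => x i + α i) = f x + δ} : ℚ) / 2 ^ (k * n)

/-- The XR-operation `(x, y) ↦ (x ⊕ y) ⋘ r`. -/
def xrOp {n : ℕ} (r : ℕ) (v : Fin 2 → BitVec n) : BitVec n :=
  (v 0 ^^^ v 1).rotateLeft r

/-- The additive differential probability `adp^XR (α, β → γ)` of the XR-operation with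
rotation by `r`. -/
noncomputable def adpXR {n : ℕ} (r : ℕ) (α β γ : BitVec n) : ℚ :=
  adp (xrOp r) ![α, β] γ

/-- `N(n, r)`: the number of impossible differentials of `(x ⊕ y) ⋘ r` on `n`-bit words,
that is, of triples `(α, β, γ)` with `adp^XR (α, β → γ) = 0`. -/
noncomputable def numImpossible (n r : ℕ) : ℕ :=
  Nat.card {t : BitVec n × BitVec n × BitVec n // adpXR r t.1 t.2.1 t.2.2 = 0}

/-!
Write `n = m + r`. A differential `(α, β → γ)` is possible when the equation defining it can be
solved for `(x, y)`, and this is decided by the carries of the three additions `x + α`, `y + β` and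
`((x ⊕ y) ⋘ r) + γ`. At the positions of `x` and `y`, read from the least significant bit, the
three carries form a state in `{0,1}³` and the three difference bits form a letter. If the letter
`w` and the state `k` have different parities, there is no continuation; otherwise the bits of `x`
and `y` may be chosen so that the next state is any `k'` with `k'ⱼ = wⱼ` wherever `kⱼ = wⱼ`
(`step_iff_exists_bits`). The carries of the first two additions start at zero. The third addition
starts at position `m`, wraps around, and ends at position `m - 1`. So, if `u` and `v` are the words
of the first `m` and the last `r` letters, the differential is possible exactly when there is a bit
`s` and a run `(0,0,s) → (p,q,*)` on `u` and `(p,q,0) → (*,*,s)` on `v` (`adpXR_eq_zero_iff`).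

The set of states reachable from a single state is again that state under one letter, a face of
the cube `{0,1}³` under three letters, and empty under the four others (`sum_next_singleton`); a
set that contains a face keeps containing one (`exists_face_subset_post`). Hence, for either `s`,
one word `u` stays at the state `(0,0,s)`, `3 (8ᵐ - 1) / 7` words lead to a set containing a
face, and the others lead nowhere. Let `Eₛ` be the number of words `v` leading from `(p,q,0)` to
`(*,*,s)`. A set containing a face has states `(p,q,*)` with `p ⊕ q` of either value, whose words
`v` are told apart by the parity of the first letter, so it allows at least `2 Eₛ` words `v`. The
first letter of `u` also determines `s`, and the number of possible differentials is therefore at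
least `(6 * 8ᵐ + 1) / 7 * (E₀ + E₁)`. The same analysis gives `E₀ ≥ (3 * 8ʳ + 4) / 7` and
`E₁ ≥ (9 * 8ʳ - 7 * 4ʳ - 2) / 21`; the loss in `E₁` comes from the face `k₃ = 0`, which is left only at a
letter with third bit `1`. For `r = 1` the bound is an equality: at most `8` letters `v` are
possible for `s = 0` and `4` for `s = 1`, which is `2 E₀` and `2 E₁`
(`card_exists_compatible_one_le`). For `r ≥ 2` the term `4ʳ` is at most `8ʳ / 4`, and the lower
bound exceeds the value at `r = 1` (`card_exists_compatible_one_lt`).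
-/

namespace XRDifferential

/-! ### The carry automaton -/

/-- A triple of bits. It serves both as a letter, made of the bits of the three differences at one
position, and as a state, made of the three carries into that position. -/
abbrev Triple := Bool × Bool × Bool

/-- The sum modulo 2 of the three bits. -/
def parity (k : Triple) : Bool := k.1 ^^ k.2.1 ^^ k.2.2

/-- The coordinates of a triple, indexed by `Fin 3`. -/
def coord (j : Fin 3) (k : Triple) : Bool := ![k.1, k.2.1, k.2.2] j

/-- The carries `k` can turn into the carries `k'` at a position whose difference bits are `w`:
the parities of `k` and `w` agree, and where the carry agrees with the difference bit it is
propagated. -/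
def Step (w k k' : Triple) : Prop :=
  parity k = parity w ∧ ∀ j, coord j k = coord j w → coord j k' = coord j w

instance (w k k' : Triple) : Decidable (Step w k k') :=
  inferInstanceAs (Decidable (_ ∧ _))

/-- The transitions of the automaton are those realised by two summand bits `a` and `b`, whose
sum modulo 2 is the third summand bit. -/
theorem step_iff_exists_bits (w k k' : Triple) :
    Step w k k' ↔ ∃ a b : Bool,
      ((a ^^ (w.1 ^^ k.1)) ^^ (b ^^ (w.2.1 ^^ k.2.1))) = ((a ^^ b) ^^ (w.2.2 ^^ k.2.2)) ∧
      k'.1 = Bool.atLeastTwo a w.1 k.1 ∧ k'.2.1 = Bool.atLeastTwo b w.2.1 k.2.1 ∧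
      k'.2.2 = Bool.atLeastTwo (a ^^ b) w.2.2 k.2.2 := by
  obtain ⟨w₁, w₂, w₃⟩ := w
  obtain ⟨k₁, k₂, k₃⟩ := k
  obtain ⟨l₁, l₂, l₃⟩ := k'
  cases w₁ <;> cases w₂ <;> cases w₃ <;> cases k₁ <;> cases k₂ <;> cases k₃ <;>
    revert l₁ l₂ l₃ <;> decide

/-- The states that can be reached from a state of `S` by reading `w`. -/
def next (w : Triple) (S : Finset Triple) : Finset Triple :=
  Finset.univ.filter fun k' => ∃ k ∈ S, Step w k k'

/-- The states that can be reached from a state of `S` by reading the word `u`. -/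
def post : {m : ℕ} → (Fin m → Triple) → Finset Triple → Finset Triple
  | 0, _, S => S
  | _ + 1, u, S => post (Fin.tail u) (next (u 0) S)

/-- The states whose `j`-th coordinate is `b`: a two-dimensional face of the cube of states. -/
def face (j : Fin 3) (b : Bool) : Finset Triple :=
  Finset.univ.filter fun k => coord j k = b

theorem mem_next {w k' : Triple} {S : Finset Triple} :
    k' ∈ next w S ↔ ∃ k ∈ S, Step w k k' := by
  simp [next]

theorem next_mono (w : Triple) {S T : Finset Triple} (h : S ⊆ T) : next w S ⊆ next w T := by
  intro k' hk'
  obtain ⟨k, hk, hs⟩ := mem_next.1 hk'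
  exact mem_next.2 ⟨k, h hk, hs⟩

theorem post_empty {m : ℕ} (u : Fin m → Triple) : post u ∅ = ∅ := by
  induction m with
  | zero => rfl
  | succ m ih =>
    have : next (u 0) ∅ = ∅ := by simp [next]
    rw [post, this, ih]

/-- Reading a word amounts to following a run of the automaton. -/
theorem mem_post_iff_exists_run {m : ℕ} (u : Fin m → Triple) (S : Finset Triple) (k' : Triple) :
    k' ∈ post u S ↔ ∃ κ : ℕ → Triple, κ 0 ∈ S ∧ κ m = k' ∧
      ∀ i : Fin m, Step (u i) (κ i) (κ (i + 1)) := by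
  induction m generalizing S with
  | zero => exact ⟨fun h => ⟨fun _ => k', h, rfl, fun i => i.elim0⟩,
      fun ⟨κ, h, e, _⟩ => e ▸ h⟩
  | succ m ih =>
    rw [post, ih]
    constructor
    · rintro ⟨κ, h0, hm, hs⟩
      obtain ⟨k, hk, hk'⟩ := mem_next.1 h0
      refine ⟨fun i => Nat.casesOn i k κ, hk, hm, fun i => ?_⟩
      refine Fin.cases hk' (fun i => ?_) i
      exact hs i
    · rintro ⟨κ, h0, hm, hs⟩
      refine ⟨fun i => κ (i + 1), mem_next.2 ⟨κ 0, h0, hs 0⟩, hm, fun i => ?_⟩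
      have := hs i.succ
      simpa [Fin.tail] using this

/-- From a single state, one letter leads back to that state, three letters lead to the three faces
through it, and the four letters of the wrong parity lead nowhere. -/
theorem sum_next_singleton (k : Triple) (f : Finset Triple → ℕ) (h : f ∅ = 0) :
    ∑ w, f (next w {k}) =
      f {k} + (f (face 0 (coord 0 k)) + f (face 1 (coord 1 k)) + f (face 2 (coord 2 k))) := by
  obtain ⟨k₁, k₂, k₃⟩ := k
  have e0 : ∀ w k : Triple, parity k ≠ parity w → next w {k} = ∅ := by decide
  have e1 : ∀ k : Triple, next k {k} = {k} := by decide
  have e2 : ∀ k : Triple, next (k.1, !k.2.1, !k.2.2) {k} = face 0 (coord 0 k) := by decide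
  have e3 : ∀ k : Triple, next (!k.1, k.2.1, !k.2.2) {k} = face 1 (coord 1 k) := by decide
  have e4 : ∀ k : Triple, next (!k.1, !k.2.1, k.2.2) {k} = face 2 (coord 2 k) := by decide
  rw [← e2 (k₁, k₂, k₃), ← e3 (k₁, k₂, k₃), ← e4 (k₁, k₂, k₃)]
  have z : ∀ w, parity (k₁, k₂, k₃) ≠ parity w → f (next w {(k₁, k₂, k₃)}) = 0 := by
    intro w hw
    rw [e0 _ _ hw, h]
  simp only [Fintype.sum_prod_type, Fintype.sum_bool]
  cases k₁ <;> cases k₂ <;> cases k₃ <;> simp (disch := decide) only [z] <;>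
    simp only [Bool.not_true, Bool.not_false, e1] <;> ring

/-- A face is contained in its successor under a letter that lies in it. -/
theorem face_subset_next_face (w : Triple) (j : Fin 3) :
    face j (coord j w) ⊆ next w (face j (coord j w)) := by
  revert w j; decide

/-- A letter outside a face leads to both of the transversal faces through the letter. -/
theorem face_subset_next_face_of_ne (w : Triple) {i j : Fin 3} (hij : i ≠ j) {b : Bool}
    (hb : coord j w ≠ b) : face i (coord i w) ⊆ next w (face j b) := by
  revert w i j b; decide

theorem next_face_two_false (w : Triple) :
    (w.2.2 = false ∧ next w (face 2 false) = face 2 false) ∨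
      (w.2.2 = true ∧ ∃ b, face 0 b ⊆ next w (face 2 false)) := by
  revert w; decide

/-- Once the set of reachable states contains a face, it does so forever. -/
theorem exists_face_subset_post {m : ℕ} (u : Fin m → Triple) {S : Finset Triple}
    (hS : ∃ j b, face j b ⊆ S) : ∃ j b, face j b ⊆ post u S := by
  induction m generalizing S with
  | zero => exact hS
  | succ m ih =>
    apply ih
    obtain ⟨j, b, hjb⟩ := hS
    by_cases hb : coord j (u 0) = b
    · subst hb
      exact ⟨j, _, (face_subset_next_face _ _).trans (next_mono _ hjb)⟩
    · have hj : j + 1 ≠ j := by clear hb hjb; revert j; decide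
      exact ⟨j + 1, _, (face_subset_next_face_of_ne _ hj hb).trans (next_mono _ hjb)⟩

/-- Once the set of reachable states contains a face other than the face `k₃ = b₀`, it does so
forever; hence it always contains a state with `k₃ ≠ b₀`. -/
theorem exists_ne_face_subset_post {m : ℕ} {b₀ : Bool} (u : Fin m → Triple) {S : Finset Triple}
    (hS : ∃ j b, (j, b) ≠ (2, b₀) ∧ face j b ⊆ S) :
    ∃ j b, (j, b) ≠ (2, b₀) ∧ face j b ⊆ post u S := by
  induction m generalizing S with
  | zero => exact hS
  | succ m ih =>
    apply ih
    obtain ⟨j, b, hne, hjb⟩ := hS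
    by_cases hb : coord j (u 0) = b
    · subst hb
      exact ⟨j, _, hne, (face_subset_next_face _ _).trans (next_mono _ hjb)⟩
    -- One of the two new faces has an index other than `2`.
    · obtain ⟨i, hij, hi2⟩ : ∃ i : Fin 3, i ≠ j ∧ i ≠ 2 := by
        clear hb hjb hne; revert j; decide
      exact ⟨i, _, fun h => hi2 (congrArg Prod.fst h),
        (face_subset_next_face_of_ne _ hij hb).trans (next_mono _ hjb)⟩

theorem exists_mem_face_third {j : Fin 3} {b s : Bool} (h : j ≠ 2 ∨ b = s) :
    ∃ k ∈ face j b, k.2.2 = s := by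
  revert j b s; decide

/-- Every face contains states whose first two coordinates have either parity. -/
theorem exists_mem_face_parity (j : Fin 3) (b p : Bool) :
    ∃ k ∈ face j b, parity (k.1, k.2.1, false) = p := by
  revert j b p; decide

theorem next_singleton_of_parity_ne {w k : Triple} (h : parity k ≠ parity w) :
    next w {k} = ∅ := by
  revert w k; decide

theorem parity_eq_of_mem_post {m : ℕ} {u : Fin (m + 1) → Triple} {k k' : Triple}
    (h : k' ∈ post u {k}) : parity k = parity (u 0) := by
  by_contra hne
  rw [post, next_singleton_of_parity_ne hne, post_empty] at h
  simp at h

/-! ### Summing over all words -/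

/-- The sum, over all words of length `m`, of the value of `f` at the set of states reached
from `S`. -/
def wordSum (f : Finset Triple → ℕ) (m : ℕ) (S : Finset Triple) : ℕ :=
  ∑ u : Fin m → Triple, f (post u S)

theorem wordSum_zero (f : Finset Triple → ℕ) (S : Finset Triple) : wordSum f 0 S = f S := by
  simp [wordSum, post]

theorem wordSum_succ (f : Finset Triple → ℕ) (m : ℕ) (S : Finset Triple) :
    wordSum f (m + 1) S = ∑ w, wordSum f m (next w S) := by
  simp only [wordSum]
  rw [← (Fin.consEquiv fun _ : Fin (m + 1) => Triple).sum_comp, Fintype.sum_prod_type]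
  rfl

theorem wordSum_empty {f : Finset Triple → ℕ} (hf : f ∅ = 0) (m : ℕ) : wordSum f m ∅ = 0 := by
  simp [wordSum, post_empty, hf]

theorem wordSum_succ_singleton {f : Finset Triple → ℕ} (hf : f ∅ = 0) (m : ℕ) (k : Triple) :
    wordSum f (m + 1) {k} = wordSum f m {k} + (wordSum f m (face 0 (coord 0 k)) +
      wordSum f m (face 1 (coord 1 k)) + wordSum f m (face 2 (coord 2 k))) := by
  rw [wordSum_succ, sum_next_singleton k _ (wordSum_empty hf m)]

theorem card_words (m : ℕ) : Fintype.card (Fin m → Triple) = 8 ^ m := by simp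

theorem mul_le_wordSum {f : Finset Triple → ℕ} {m : ℕ} {S : Finset Triple} {B : ℕ}
    (h : ∀ u : Fin m → Triple, B ≤ f (post u S)) : 8 ^ m * B ≤ wordSum f m S := by
  have := Finset.card_nsmul_le_sum Finset.univ (fun u : Fin m → Triple => f (post u S)) B
    fun u _ => h u
  rwa [Finset.card_univ, card_words, smul_eq_mul] at this

theorem wordSum_le_mul {f : Finset Triple → ℕ} {m : ℕ} {S : Finset Triple} {B : ℕ}
    (h : ∀ u : Fin m → Triple, f (post u S) ≤ B) : wordSum f m S ≤ 8 ^ m * B := by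
  have := Finset.sum_le_card_nsmul Finset.univ (fun u : Fin m → Triple => f (post u S)) B
    fun u _ => h u
  rwa [Finset.card_univ, card_words, smul_eq_mul] at this

/-- From a single state of weight at least `A`, exactly `3 * (8 ^ m - 1) / 7` words of length `m`
reach a set containing a face, and one more word stays at the single state. -/
theorem le_wordSum_singleton {f : Finset Triple → ℕ} (hf : f ∅ = 0) {A B : ℕ}
    (hface : ∀ S, (∃ j b, face j b ⊆ S) → B ≤ f S) (k : Triple) (hA : A ≤ f {k}) (m : ℕ) :
    7 * A + 3 * B * 8 ^ m ≤ 7 * wordSum f m {k} + 3 * B := by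
  have hB : ∀ m j b, 8 ^ m * B ≤ wordSum f m (face j b) := fun m j b =>
    mul_le_wordSum fun u => hface _ (exists_face_subset_post u ⟨j, b, subset_rfl⟩)
  induction m with
  | zero => rw [wordSum_zero]; omega
  | succ m ih =>
    rw [wordSum_succ_singleton hf, pow_succ]
    have h0 := hB m 0 (coord 0 k)
    have h1 := hB m 1 (coord 1 k)
    have h2 := hB m 2 (coord 2 k)
    linarith

theorem wordSum_singleton_le {f : Finset Triple → ℕ} (hf : f ∅ = 0) {A B : ℕ}
    (hB : ∀ S, f S ≤ B) (k : Triple) (hA : f {k} ≤ A) (m : ℕ) :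
    7 * wordSum f m {k} + 3 * B ≤ 7 * A + 3 * B * 8 ^ m := by
  induction m with
  | zero => rw [wordSum_zero]; omega
  | succ m ih =>
    rw [wordSum_succ_singleton hf, pow_succ]
    have h0 := wordSum_le_mul (m := m) (S := face 0 (coord 0 k)) fun u => hB (post u _)
    have h1 := wordSum_le_mul (m := m) (S := face 1 (coord 1 k)) fun u => hB (post u _)
    have h2 := wordSum_le_mul (m := m) (S := face 2 (coord 2 k)) fun u => hB (post u _)
    linarith

/-! ### Words on the rotated part -/

/-- Indicator of the sets that contain a state with third coordinate `s`. -/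
def finish (s : Bool) (S : Finset Triple) : ℕ := if ∃ k ∈ S, k.2.2 = s then 1 else 0

/-- The state `k` with its third carry reset to zero. -/
def reset (k : Triple) : Triple := (k.1, k.2.1, false)

/-- The number of words of length `r` that lead from the state `c` to some state with third
coordinate `s`. -/
def arrivals (r : ℕ) (s : Bool) (c : Triple) : ℕ :=
  (Finset.univ.filter fun v : Fin r → Triple => ∃ k ∈ post v {c}, k.2.2 = s).card

theorem arrivals_eq_wordSum (r : ℕ) (s : Bool) (c : Triple) :
    arrivals r s c = wordSum (finish s) r {c} := by
  rw [arrivals, wordSum, Finset.card_filter]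
  rfl

theorem finish_empty (s : Bool) : finish s ∅ = 0 := by simp [finish]

theorem eight_pow_le_wordSum_finish {s b : Bool} {j : Fin 3} {S : Finset Triple}
    (hjb : face j b ⊆ S) (h : (j, b) ≠ (2, !s)) (m : ℕ) :
    8 ^ m ≤ wordSum (finish s) m S := by
  rw [← mul_one (8 ^ m)]
  refine mul_le_wordSum fun u => ?_
  obtain ⟨j', b', hne, hsub⟩ := exists_ne_face_subset_post u ⟨j, b, h, hjb⟩
  have hj : j' ≠ 2 ∨ b' = s := by
    clear hsub h; revert j' b' s; decide
  obtain ⟨k, hk, hks⟩ := exists_mem_face_third hj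
  rw [finish, if_pos ⟨k, hsub hk, hks⟩]

/-- Among the words read from the face `k₃ = 0`, only the `4 ^ m` words all of whose third bits
vanish never leave that face. -/
theorem eight_pow_le_wordSum_face_two (m : ℕ) :
    8 ^ m ≤ wordSum (finish true) m (face 2 false) + 4 ^ m := by
  induction m with
  | zero => simp
  | succ m ih =>
    rw [wordSum_succ]
    have h4 : ∑ w : Triple, (if w.2.2 = true then 0 else 4 ^ m) = 4 ^ (m + 1) := by
      simp [Fintype.sum_prod_type, pow_succ]
      ring
    rw [← h4, ← Finset.sum_add_distrib]
    have h8 : 8 ^ (m + 1) = ∑ w : Triple, 8 ^ m := by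
      simp [pow_succ, mul_comm]
    rw [h8]
    refine Finset.sum_le_sum fun w _ => ?_
    rcases next_face_two_false w with ⟨hw, h⟩ | ⟨hw, b, h⟩
    · simpa [h, hw] using ih
    · exact (eight_pow_le_wordSum_finish h (by simp) m).trans (Nat.le_add_right _ _)

theorem le_arrivals_false (r : ℕ) {c : Triple} (hc : c.2.2 = false) :
    3 * 8 ^ r + 4 ≤ 7 * arrivals r false c := by
  rw [arrivals_eq_wordSum]
  induction r with
  | zero =>
    rw [wordSum_zero, finish, if_pos ⟨c, Finset.mem_singleton_self c, hc⟩]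
    norm_num
  | succ r ih =>
    rw [wordSum_succ_singleton (finish_empty _), pow_succ]
    have h0 := eight_pow_le_wordSum_finish (s := false) (subset_refl (face 0 (coord 0 c)))
      (by simp) r
    have h1 := eight_pow_le_wordSum_finish (s := false) (subset_refl (face 1 (coord 1 c)))
      (by simp) r
    have h2 := eight_pow_le_wordSum_finish (s := false) (subset_refl (face 2 (coord 2 c)))
      (by simp [coord, hc]) r
    linarith

theorem le_arrivals_true (r : ℕ) {c : Triple} (hc : c.2.2 = false) :
    9 * 8 ^ r ≤ 21 * arrivals r true c + 7 * 4 ^ r + 2 := by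
  rw [arrivals_eq_wordSum]
  induction r with
  | zero => simp
  | succ r ih =>
    rw [wordSum_succ_singleton (finish_empty _), pow_succ, pow_succ]
    have h0 := eight_pow_le_wordSum_finish (s := true) (subset_refl (face 0 (coord 0 c)))
      (by simp) r
    have h1 := eight_pow_le_wordSum_finish (s := true) (subset_refl (face 1 (coord 1 c)))
      (by simp) r
    have h2 := eight_pow_le_wordSum_face_two r
    have hc' : coord 2 c = false := by simp [coord, hc]
    rw [hc']
    linarith

theorem arrivals_one_le (s : Bool) {c : Triple} (hc : c.2.2 = false) :
    arrivals 1 s c ≤ if s then 2 else 4 := by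
  rw [arrivals_eq_wordSum, wordSum_succ]
  simp only [wordSum_zero]
  revert s c
  decide

/-! ### Counting pairs of words -/

/-- The words `u` and `v` admit a common run in which the third carry is `s` before `u` and after
`v`, and zero between them, while the first two carries start at zero and pass from `u` to `v`. -/
def Compatible {m r : ℕ} (s : Bool) (u : Fin m → Triple) (v : Fin r → Triple) : Prop :=
  ∃ k ∈ post u {(false, false, s)}, ∃ k' ∈ post v {reset k}, k'.2.2 = s

instance {m r : ℕ} (s : Bool) (u : Fin m → Triple) (v : Fin r → Triple) :
    Decidable (Compatible s u v) :=
  inferInstanceAs (Decidable (∃ k ∈ post u {(false, false, s)}, _))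

/-- The number of words of length `r` that lead from some state of `S`, with the third carry reset,
to some state with third coordinate `s`. -/
def weight (r : ℕ) (s : Bool) (S : Finset Triple) : ℕ :=
  (Finset.univ.filter fun v : Fin r → Triple =>
    ∃ c ∈ S, ∃ k ∈ post v {reset c}, k.2.2 = s).card

theorem weight_empty (r : ℕ) (s : Bool) : weight r s ∅ = 0 := by simp [weight]

theorem weight_singleton (r : ℕ) (s : Bool) (k : Triple) :
    weight r s {k} = arrivals r s (reset k) := by
  simp [weight, arrivals]

/-- The two parity classes of states are left by disjoint sets of words. -/
theorem le_weight_of_face_subset {r : ℕ} (hr : r ≠ 0) {s : Bool} {A : ℕ}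
    (hA : ∀ c : Triple, A ≤ arrivals r s (reset c)) {S : Finset Triple}
    (hS : ∃ j b, face j b ⊆ S) : 2 * A ≤ weight r s S := by
  obtain ⟨r, rfl⟩ := Nat.exists_eq_add_one_of_ne_zero hr
  obtain ⟨j, b, hS⟩ := hS
  obtain ⟨c, hc, hpc⟩ := exists_mem_face_parity j b false
  obtain ⟨d, hd, hpd⟩ := exists_mem_face_parity j b true
  have hdisj : Disjoint
      (Finset.univ.filter fun v : Fin (r + 1) → Triple =>
        ∃ k ∈ post v {reset c}, k.2.2 = s)
      (Finset.univ.filter fun v : Fin (r + 1) → Triple =>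
        ∃ k ∈ post v {reset d}, k.2.2 = s) := by
    refine Finset.disjoint_filter.2 fun v _ ⟨k, hk, _⟩ ⟨k', hk', _⟩ => ?_
    have h := (parity_eq_of_mem_post hk).trans (parity_eq_of_mem_post hk').symm
    rw [reset, reset, hpc, hpd] at h
    exact absurd h (by decide)
  calc 2 * A ≤ arrivals (r + 1) s (reset c) + arrivals (r + 1) s (reset d) := by
        have := hA c; have := hA d; omega
    _ ≤ weight (r + 1) s S := by
        rw [arrivals, arrivals, ← Finset.card_union_of_disjoint hdisj]
        refine Finset.card_le_card fun v hv => ?_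
        simp only [Finset.mem_union, Finset.mem_filter, Finset.mem_univ, true_and] at hv ⊢
        rcases hv with hv | hv
        · exact ⟨c, hS hc, hv⟩
        · exact ⟨d, hS hd, hv⟩

theorem weight_one_le (s : Bool) (S : Finset Triple) :
    weight 1 s S ≤ 2 * if s then 2 else 4 := by
  have hmono : weight 1 s S ≤
      (Finset.univ.filter fun w : Triple => ∃ c, ∃ k ∈ next w {reset c}, k.2.2 = s).card := by
    refine Finset.card_le_card_of_injOn (fun v => v 0) (fun v hv => ?_) fun v _ v' _ h => ?_
    · simp only [Finset.coe_filter, Finset.mem_univ, true_and, Set.mem_ofPred_eq] at hv ⊢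
      obtain ⟨c, _, h⟩ := hv
      exact ⟨c, h⟩
    · funext i
      rw [Subsingleton.elim i 0]
      exact h
  refine hmono.trans ?_
  clear hmono
  revert s
  decide

theorem card_compatible_eq_wordSum (m r : ℕ) (s : Bool) :
    (Finset.univ.filter fun p : (Fin m → Triple) × (Fin r → Triple) =>
      Compatible s p.1 p.2).card = wordSum (weight r s) m {(false, false, s)} := by
  rw [wordSum, Finset.card_filter, Fintype.sum_prod_type]
  refine Finset.sum_congr rfl fun u _ => ?_
  rw [weight, Finset.card_filter]
  rfl

/-- The parity of the first letter determines the third carry before `u`. -/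
theorem card_exists_compatible {m : ℕ} (hm : m ≠ 0) (r : ℕ) :
    (Finset.univ.filter fun p : (Fin m → Triple) × (Fin r → Triple) =>
      ∃ s, Compatible s p.1 p.2).card =
    wordSum (weight r false) m {(false, false, false)} +
      wordSum (weight r true) m {(false, false, true)} := by
  obtain ⟨m, rfl⟩ := Nat.exists_eq_add_one_of_ne_zero hm
  rw [← card_compatible_eq_wordSum, ← card_compatible_eq_wordSum,
    ← Finset.card_union_of_disjoint]
  · congr 1
    ext p
    simp
  · refine Finset.disjoint_filter.2 fun p _ ⟨k, hk, _⟩ ⟨k', hk', _⟩ => ?_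
    have h := (parity_eq_of_mem_post hk).trans (parity_eq_of_mem_post hk').symm
    exact absurd h (by decide)

theorem card_exists_compatible_one_le {m : ℕ} (hm : m ≠ 0) :
    7 * (Finset.univ.filter fun p : (Fin m → Triple) × (Fin 1 → Triple) =>
      ∃ s, Compatible s p.1 p.2).card ≤ 36 * 8 ^ m + 6 := by
  have h : ∀ s, _ := fun s => wordSum_singleton_le (weight_empty 1 s) (weight_one_le s)
    (false, false, s) ((weight_singleton 1 s _).trans_le (arrivals_one_le s rfl)) m
  rw [card_exists_compatible hm]
  have h0 := h false
  have h1 := h true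
  simp only [if_true, Bool.false_eq_true, if_false] at h0 h1
  linarith

theorem le_card_exists_compatible {m r : ℕ} (hm : m ≠ 0) (hr : r ≠ 0) :
    (6 * 8 ^ m + 1) * (18 * 8 ^ r + 10) ≤
    147 * (Finset.univ.filter fun p : (Fin m → Triple) × (Fin r → Triple) =>
      ∃ s, Compatible s p.1 p.2).card + (6 * 8 ^ m + 1) * (7 * 4 ^ r) := by
  have h : ∀ s, ∃ c, c.2.2 = false ∧
      (6 * 8 ^ m + 1) * arrivals r s c ≤ 7 * wordSum (weight r s) m {(false, false, s)} := by
    intro s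
    -- The numbers of arrivals all coincide; taking the least one makes this fact unnecessary.
    obtain ⟨c, hc⟩ := Finite.exists_min fun c => arrivals r s (reset c)
    have := le_wordSum_singleton (weight_empty r s)
      (fun S hS => le_weight_of_face_subset hr hc hS) (false, false, s)
      ((hc _).trans_eq (weight_singleton r s _).symm) m
    exact ⟨reset c, rfl, by linarith⟩
  obtain ⟨c, hc, h0⟩ := h false
  obtain ⟨d, hd, h1⟩ := h true
  rw [card_exists_compatible hm]
  have hcd : 18 * 8 ^ r + 10 ≤ 21 * arrivals r false c + 21 * arrivals r true d + 7 * 4 ^ r := by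
    have := le_arrivals_false r hc
    have := le_arrivals_true r hd
    omega
  have := Nat.mul_le_mul_left (6 * 8 ^ m + 1) hcd
  linarith

/-- Rotations by `r ≥ 2` bits admit more pairs of compatible words than the rotation by one bit. -/
theorem card_exists_compatible_one_lt {m r l : ℕ} (hm : m ≠ 0) (hr : 2 ≤ r) (hl : l + 1 = m + r) :
    (Finset.univ.filter fun p : (Fin l → Triple) × (Fin 1 → Triple) =>
      ∃ s, Compatible s p.1 p.2).card <
    (Finset.univ.filter fun p : (Fin m → Triple) × (Fin r → Triple) =>
      ∃ s, Compatible s p.1 p.2).card := by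
  have h1 := card_exists_compatible_one_le (m := l) (by omega)
  have h2 := le_card_exists_compatible hm (r := r) (by omega)
  have hXY : 8 * 8 ^ l = 8 ^ m * 8 ^ r := by rw [← pow_add, ← hl, pow_succ, mul_comm]
  obtain ⟨t, rfl⟩ := Nat.exists_eq_add_of_le hr
  have h8 : 4 * 4 ^ (2 + t) ≤ 8 ^ (2 + t) := by
    rw [pow_add, pow_add]
    have := Nat.pow_le_pow_left (show 4 ≤ 8 by norm_num) t
    omega
  have hX : 8 ≤ 8 ^ m := Nat.le_self_pow hm 8
  have hZ : 1 ≤ 4 ^ (2 + t) := Nat.one_le_pow _ _ (by norm_num)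
  have h8' := Nat.mul_le_mul_left (8 ^ m) h8
  generalize 8 ^ m = X at *
  generalize 8 ^ (2 + t) = Y at *
  generalize 4 ^ (2 + t) = Z at *
  have hXZ : X ≤ X * Z := Nat.le_mul_of_pos_right _ hZ
  generalize Finset.card _ = Q at *
  generalize Finset.card _ = R at *
  -- With `147` as common denominator, the claim is `42XZ + 7Z + 116 < 13.5XY + 60X + 18Y`, which
  -- follows from `4Z ≤ Y` and `8 ≤ X`.
  nlinarith

/-! ### From bit vectors to words -/

/-- The words attached to three differences: the first collects the positions `0, …, m - 1` of the
summands, the second the remaining `r` positions. The bits of the output difference are listed at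
the positions from which the rotation by `r` bits takes them. -/
def toWords {m r : ℕ} (t : BitVec (m + r) × BitVec (m + r) × BitVec (m + r)) :
    (Fin m → Triple) × (Fin r → Triple) :=
  (fun i => (t.1.getLsbD i, t.2.1.getLsbD i, t.2.2.getLsbD (r + i)),
    fun i => (t.1.getLsbD (m + i), t.2.1.getLsbD (m + i), t.2.2.getLsbD i))

theorem toWords_bijective (m r : ℕ) : Function.Bijective (toWords (m := m) (r := r)) := by
  refine (Fintype.bijective_iff_injective_and_card _).2 ⟨?_, ?_⟩
  · rintro ⟨α, β, γ⟩ ⟨α', β', γ'⟩ h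
    have hu : ∀ i : Fin m, _ := fun i => congrFun (congrArg Prod.fst h) i
    have hv : ∀ i : Fin r, _ := fun i => congrFun (congrArg Prod.snd h) i
    simp only [toWords, Prod.mk.injEq] at hu hv
    refine Prod.ext ?_ (Prod.ext ?_ ?_) <;> refine BitVec.eq_of_getLsbD_eq fun i hi => ?_
    · rcases lt_or_ge i m with him | him
      · exact (hu ⟨i, him⟩).1
      · obtain ⟨j, rfl⟩ := Nat.exists_eq_add_of_le him
        exact (hv ⟨j, by omega⟩).1
    · rcases lt_or_ge i m with him | him
      · exact (hu ⟨i, him⟩).2.1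
      · obtain ⟨j, rfl⟩ := Nat.exists_eq_add_of_le him
        exact (hv ⟨j, by omega⟩).2.1
    · rcases lt_or_ge i r with hir | hir
      · exact (hv ⟨i, hir⟩).2.2
      · obtain ⟨j, rfl⟩ := Nat.exists_eq_add_of_le hir
        exact (hu ⟨j, by omega⟩).2.2
  · have hb : ∀ n, Fintype.card (BitVec n) = 2 ^ n := fun n => by
      rw [Fintype.card_congr BitVec.equivFin.toEquiv, Fintype.card_fin]
    rw [Fintype.card_prod, Fintype.card_prod, Fintype.card_prod, card_words, card_words, hb,
      ← pow_add, ← pow_add, ← pow_add, show (8 : ℕ) = 2 ^ 3 by norm_num, ← pow_mul]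
    congr 1
    ring

theorem getLsbD_rotateLeft_add {m r i : ℕ} (z : BitVec (m + r)) (hi : i < m) :
    (z.rotateLeft r).getLsbD (r + i) = z.getLsbD i := by
  rw [BitVec.getLsbD_rotateLeft_of_le (by omega)]
  have h1 : ¬ r + i < r := by omega
  have h2 : r + i < m + r := by omega
  simp [h2]

theorem getLsbD_rotateLeft_of_lt {m r i : ℕ} (hm : m ≠ 0) (z : BitVec (m + r)) (hi : i < r) :
    (z.rotateLeft r).getLsbD i = z.getLsbD (m + i) := by
  rw [BitVec.getLsbD_rotateLeft_of_le (by omega)]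
  simp [hi]

/-- Equality of a rotated word with a sum, bit by bit in the positions before the rotation. -/
theorem rotateLeft_eq_add_iff {m r : ℕ} (hm : m ≠ 0) (z z' γ : BitVec (m + r)) :
    z'.rotateLeft r = z.rotateLeft r + γ ↔
      (∀ i < m, z'.getLsbD i = (z.getLsbD i ^^ (γ.getLsbD (r + i) ^^
        BitVec.carry (r + i) (z.rotateLeft r) γ false))) ∧
      (∀ i < r, z'.getLsbD (m + i) = (z.getLsbD (m + i) ^^ (γ.getLsbD i ^^
        BitVec.carry i (z.rotateLeft r) γ false))) := by
  constructor
  · intro h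
    refine ⟨fun i hi => ?_, fun i hi => ?_⟩
    · rw [← getLsbD_rotateLeft_add z' hi, h, BitVec.getLsbD_add (by omega),
        getLsbD_rotateLeft_add z hi]
    · rw [← getLsbD_rotateLeft_of_lt hm z' hi, h, BitVec.getLsbD_add (by omega),
        getLsbD_rotateLeft_of_lt hm z hi]
  · rintro ⟨h1, h2⟩
    refine BitVec.eq_of_getLsbD_eq fun i hi => ?_
    rw [BitVec.getLsbD_add hi]
    rcases lt_or_ge i r with hir | hir
    · rw [getLsbD_rotateLeft_of_lt hm _ hir, getLsbD_rotateLeft_of_lt hm _ hir, h2 i hir]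
    · obtain ⟨j, rfl⟩ := Nat.exists_eq_add_of_le hir
      have hj : j < m := by omega
      rw [getLsbD_rotateLeft_add _ hj, getLsbD_rotateLeft_add _ hj, h1 j hj]

/-- The carries of the three additions of a solution form a run on the two words. The output
addition starts with the second word, which explains the reset of the third carry, and ends with
the first one. -/
theorem exists_compatible_of_solution {m r : ℕ} (hm : m ≠ 0) {α β γ x y : BitVec (m + r)}
    (h : ((x + α) ^^^ (y + β)).rotateLeft r = (x ^^^ y).rotateLeft r + γ) :
    ∃ s, Compatible s (toWords (α, β, γ)).1 (toWords (α, β, γ)).2 := by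
  obtain ⟨h1, h2⟩ := (rotateLeft_eq_add_iff hm _ _ _).1 h
  set z := (x ^^^ y).rotateLeft r with hz
  refine ⟨BitVec.carry r z γ false,
    (BitVec.carry m x α false, BitVec.carry m y β false, BitVec.carry (r + m) z γ false),
    (mem_post_iff_exists_run _ _ _).2 ⟨fun i => (BitVec.carry i x α false,
      BitVec.carry i y β false, BitVec.carry (r + i) z γ false), by simp, rfl, fun i => ?_⟩,
    (BitVec.carry (m + r) x α false, BitVec.carry (m + r) y β false, BitVec.carry r z γ false),
    (mem_post_iff_exists_run _ _ _).2 ⟨fun i => (BitVec.carry (m + i) x α false,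
      BitVec.carry (m + i) y β false, BitVec.carry i z γ false), by simp [reset], rfl,
      fun i => ?_⟩, rfl⟩
  · have hb := h1 i i.2
    rw [BitVec.getLsbD_xor, BitVec.getLsbD_xor, BitVec.getLsbD_add (by omega),
      BitVec.getLsbD_add (by omega)] at hb
    refine (step_iff_exists_bits _ _ _).2 ⟨x.getLsbD i, y.getLsbD i, hb, ?_, ?_, ?_⟩
    · exact BitVec.carry_succ _ _ _ _
    · exact BitVec.carry_succ _ _ _ _
    · dsimp only
      rw [← add_assoc, BitVec.carry_succ, hz, getLsbD_rotateLeft_add _ i.2, BitVec.getLsbD_xor]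
      rfl
  · have hb := h2 i i.2
    rw [BitVec.getLsbD_xor, BitVec.getLsbD_xor, BitVec.getLsbD_add (by omega),
      BitVec.getLsbD_add (by omega)] at hb
    refine (step_iff_exists_bits _ _ _).2 ⟨x.getLsbD (m + i), y.getLsbD (m + i), hb, ?_, ?_, ?_⟩
    · exact BitVec.carry_succ _ _ _ _
    · exact BitVec.carry_succ _ _ _ _
    · dsimp only
      rw [BitVec.carry_succ, hz, getLsbD_rotateLeft_of_lt hm _ i.2, BitVec.getLsbD_xor]
      rfl

/-- A bit vector with prescribed low and high bits. -/
theorem exists_bitVec_getLsbD (m r : ℕ) (a : Fin m → Bool) (b : Fin r → Bool) :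
    ∃ x : BitVec (m + r), (∀ i : Fin m, x.getLsbD i = a i) ∧
      ∀ i : Fin r, x.getLsbD (m + i) = b i := by
  obtain ⟨⟨x, t⟩, hx⟩ := (toWords_bijective m r).surjective
    (fun i => (a i, false, false), fun i => (b i, false, false))
  refine ⟨x, fun i => ?_, fun i => ?_⟩
  · exact congrArg Prod.fst (congrFun (congrArg Prod.fst hx) i)
  · exact congrArg Prod.fst (congrFun (congrArg Prod.snd hx) i)

/-- A sequence obeying the carry recursion on an interval is the sequence of carries there, once it
starts with the right carry. -/
theorem carry_eq_of_recursion {n : ℕ} (x y : BitVec n) (d l : ℕ) (c : ℕ → Bool)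
    (h0 : BitVec.carry d x y false = c 0)
    (hs : ∀ i < l, c (i + 1) = Bool.atLeastTwo (x.getLsbD (d + i)) (y.getLsbD (d + i)) (c i)) :
    ∀ i ≤ l, BitVec.carry (d + i) x y false = c i := by
  intro i
  induction i with
  | zero => exact fun _ => h0
  | succ i ih =>
    intro hi
    rw [← add_assoc, BitVec.carry_succ, ih (by omega), hs i (by omega)]

theorem exists_solution_of_compatible {m r : ℕ} (hm : m ≠ 0) {α β γ : BitVec (m + r)} {s : Bool}
    (h : Compatible s (toWords (α, β, γ)).1 (toWords (α, β, γ)).2) :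
    ∃ x y : BitVec (m + r),
      ((x + α) ^^^ (y + β)).rotateLeft r = (x ^^^ y).rotateLeft r + γ := by
  obtain ⟨k, hk, k', hk', hs⟩ := h
  obtain ⟨κ, κ0, κm, hκ⟩ := (mem_post_iff_exists_run _ _ _).1 hk
  obtain ⟨l, l0, lr, hl⟩ := (mem_post_iff_exists_run _ _ _).1 hk'
  rw [Finset.mem_singleton] at κ0 l0
  choose a b hab ha hb hc using fun i => (step_iff_exists_bits _ _ _).1 (hκ i)
  choose a' b' hab' ha' hb' hc' using fun i => (step_iff_exists_bits _ _ _).1 (hl i)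
  obtain ⟨x, hx, hx'⟩ := exists_bitVec_getLsbD m r a a'
  obtain ⟨y, hy, hy'⟩ := exists_bitVec_getLsbD m r b b'
  have cx : ∀ i ≤ m, BitVec.carry (0 + i) x α false = (κ i).1 :=
    carry_eq_of_recursion x α 0 m (fun i => (κ i).1) (by simp [κ0]) fun i hi => by
      rw [zero_add, hx ⟨i, hi⟩]; exact ha ⟨i, hi⟩
  have cy : ∀ i ≤ m, BitVec.carry (0 + i) y β false = (κ i).2.1 :=
    carry_eq_of_recursion y β 0 m (fun i => (κ i).2.1) (by simp [κ0]) fun i hi => by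
      rw [zero_add, hy ⟨i, hi⟩]; exact hb ⟨i, hi⟩
  simp only [zero_add] at cx cy
  have cx' : ∀ i ≤ r, BitVec.carry (m + i) x α false = (l i).1 :=
    carry_eq_of_recursion x α m r (fun i => (l i).1) (by simp [cx, κm, l0, reset])
      fun i hi => by rw [hx' ⟨i, hi⟩]; exact ha' ⟨i, hi⟩
  have cy' : ∀ i ≤ r, BitVec.carry (m + i) y β false = (l i).2.1 :=
    carry_eq_of_recursion y β m r (fun i => (l i).2.1) (by simp [cy, κm, l0, reset])
      fun i hi => by rw [hy' ⟨i, hi⟩]; exact hb' ⟨i, hi⟩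
  have cz' : ∀ i ≤ r, BitVec.carry (0 + i) ((x ^^^ y).rotateLeft r) γ false = (l i).2.2 :=
    carry_eq_of_recursion _ γ 0 r (fun i => (l i).2.2) (by simp [l0, reset]) fun i hi => by
      rw [zero_add, getLsbD_rotateLeft_of_lt hm _ hi, BitVec.getLsbD_xor, hx' ⟨i, hi⟩,
        hy' ⟨i, hi⟩]
      exact hc' ⟨i, hi⟩
  simp only [zero_add] at cz'
  have cz : ∀ i ≤ m, BitVec.carry (r + i) ((x ^^^ y).rotateLeft r) γ false = (κ i).2.2 :=
    carry_eq_of_recursion _ γ r m (fun i => (κ i).2.2) (by simp [cz', lr, hs, κ0])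
      fun i hi => by
        rw [getLsbD_rotateLeft_add _ hi, BitVec.getLsbD_xor, hx ⟨i, hi⟩, hy ⟨i, hi⟩]
        exact hc ⟨i, hi⟩
  refine ⟨x, y, (rotateLeft_eq_add_iff hm _ _ _).2 ⟨fun i hi => ?_, fun i hi => ?_⟩⟩
  · rw [BitVec.getLsbD_xor, BitVec.getLsbD_xor, BitVec.getLsbD_add (by omega),
      BitVec.getLsbD_add (by omega), cx i hi.le, cy i hi.le, cz i hi.le, hx ⟨i, hi⟩, hy ⟨i, hi⟩]
    exact hab ⟨i, hi⟩
  · rw [BitVec.getLsbD_xor, BitVec.getLsbD_xor, BitVec.getLsbD_add (by omega),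
      BitVec.getLsbD_add (by omega), cx' i hi.le, cy' i hi.le, cz' i hi.le, hx' ⟨i, hi⟩,
      hy' ⟨i, hi⟩]
    exact hab' ⟨i, hi⟩

theorem adpXR_eq_zero_iff {m r : ℕ} (hm : m ≠ 0)
    (t : BitVec (m + r) × BitVec (m + r) × BitVec (m + r)) :
    adpXR r t.1 t.2.1 t.2.2 = 0 ↔ ¬ ∃ s, Compatible s (toWords t).1 (toWords t).2 := by
  obtain ⟨α, β, γ⟩ := t
  rw [adpXR, adp, div_eq_zero_iff, or_iff_left (by positivity), Nat.cast_eq_zero,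
    Nat.card_eq_zero, or_iff_left (not_infinite_iff_finite.2 inferInstance), isEmpty_subtype,
    ← not_exists, not_iff_not]
  constructor
  · rintro ⟨v, hv⟩
    exact exists_compatible_of_solution hm (by simpa [xrOp] using hv)
  · rintro ⟨s, hs⟩
    obtain ⟨x, y, hxy⟩ := exists_solution_of_compatible hm hs
    exact ⟨![x, y], by simpa [xrOp] using hxy⟩

theorem numImpossible_add_card {m r : ℕ} (hm : m ≠ 0) :
    numImpossible (m + r) r +
      (Finset.univ.filter fun p : (Fin m → Triple) × (Fin r → Triple) =>
        ∃ s, Compatible s p.1 p.2).card = 8 ^ (m + r) := by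
  have h : numImpossible (m + r) r =
      (Finset.univ.filter fun p : (Fin m → Triple) × (Fin r → Triple) =>
        ¬ ∃ s, Compatible s p.1 p.2).card := by
    rw [numImpossible, ← Fintype.card_subtype, ← Nat.card_eq_fintype_card]
    exact Nat.card_congr ((Equiv.ofBijective _ (toWords_bijective m r)).subtypeEquiv
      (adpXR_eq_zero_iff hm))
  rw [h, add_comm, Finset.card_filter_add_card_filter_not, Finset.card_univ, Fintype.card_prod,
    card_words, card_words, pow_add]

end XRDifferential

/-- Among the rotations by `1, …, n - 1` bits, the one-bit left rotation has strictly the most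
impossible differentials. -/
theorem mainTheorem3 (n : ℕ) (hn : 5 ≤ n) (r : ℕ) (hr₁ : 2 ≤ r) (hr₂ : r ≤ n - 1) :
    numImpossible n r < numImpossible n 1 := by
  obtain ⟨m, rfl⟩ : ∃ m, n = m + r := ⟨n - r, by omega⟩
  obtain ⟨l, hl⟩ : ∃ l, m + r = l + 1 := ⟨m + r - 1, by omega⟩
  have hm : m ≠ 0 := by omega
  have h1 := XRDifferential.numImpossible_add_card (m := l) (r := 1) (by omega)
  have h2 := XRDifferential.numImpossible_add_card (r := r) hm
  have h3 := XRDifferential.card_exists_compatible_one_lt hm hr₁ hl.symm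
  rw [← hl] at h1
  omega
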